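/- **Setting.** Let $\mathbb X\subset\mathbb R^m$ be compact. Followers $i=1,\dots,n$ and a leader evolve in $\mathbb X$ according to $$\dot x_i=f(x_i)+u_i+h(x_i),\qquad \dot x_l=f_l(x_l,t),\qquad t\ge 0 .$$ The unknown functions $f,h:\mathbb X\to\mathbb R^m$ are random, defined on a probability space, and almost surely bounded and continuously differentiable on $\mathbb X$. Put $\tau=f+h$. The function $f_l$ is continuous and $\|f_l(x,t)\|<\bar f_l$ for all $x\in\mathbb X$, $t\ge0$, with a constant $\bar f_l>0$. The followers communicate over a connected undirected graph with adjacency matrix $(a_{ij})$ and Laplacian $L$. The leader is linked to at least one follower; $b_{ii}=1$ if it is linked to follower $i$, $b_{ii}=0$ otherwise, $B=\mathrm{diag}(b_{ii})$. The gains are $k_i>0$, $k^*=\min_i k_i$. Agent $j$ has training inputs $X_j^{(1)},\dots,X_j^{(M_j)}\in\mathbb X$ and, for each coordinate $k$, outputs $y_{j,k}^{(p)}=\tau_k(X_j^{(p)})+\varsigma_{j,k}^{(p)}$. Let $\sigma_o^2>0$, and let $\kappa_k$ be a positive semidefinite, Lipschitz kernel on $\mathbb X$ with $\kappa_k(x,x)>0$.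 With $\mathbf k_{jk}(x)=(\kappa_k(x,X_j^{(p)}))_p$ and $K_{jk}=(\kappa_k(X_j^{(p)},X_j^{(q)}))_{p,q}$ put $$\mu_{jk}(x)=\mathbf k_{jk}(x)^\top(K_{jk}+\sigma_o^2I)^{-1}y_{j,k},\qquad \sigma_{jk}^2(x)=\kappa_k(x,x)-\mathbf k_{jk}(x)^\top(K_{jk}+\sigma_o^2I)^{-1}\mathbf k_{jk}(x).$$ The prediction $\tilde\mu_i$ of agent $i$ has the coordinates $\tilde\mu_{ik}=\sum_j w_{ik}^{jk}\mu_{jk}$, where $w_{ik}^{ik}=\sigma_{ik}^{-2}/\tilde\sigma_{ik}^{-2}$, $w_{ik}^{jk}=a_{ij}\sigma_{jk}^{-2}/\tilde\sigma_{ik}^{-2}$ for $j\ne i$, and $\tilde\sigma_{ik}^{-2}=\sigma_{ik}^{-2}+\sum_j a_{ij}\sigma_{jk}^{-2}$. The control law is $$u_i=-k_i\xi_i-\tilde\mu_i(x_i),\qquad \xi_i=\sum_j a_{ij}(x_i-x_j)+b_{ii}(x_i-x_l).$$ **Tracking property.** For a realization of $f,h$ and the noise, we say that *tracking holds* if for every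 solution of the closed loop that stays in $\mathbb X$ for all $t\ge0$, the function $\sum_{i=1}^n\big(\bar f_l^2+\|\tau(x_i(t))-\tilde\mu_i(x_i(t))\|^2\big)$ is bounded above for large $t$ and, with $$\nu=\limsup_{t\to\infty}\sum_{i=1}^n\Big(\bar f_l^2+\big\|\tau(x_i(t))-\tilde\mu_i(x_i(t))\big\|^2\Big),\qquad r=\frac{\sqrt{2\nu}}{k^*\,\lambda_{\min}(L+B)},$$ practical consensus holds with constant $r$, that is $r>0$ and $\limsup_{t\to\infty}\|x_i(t)-x_l(t)\|\le r$ for every $i$, and the global tracking error $e=(x_1-x_l,\dots,x_n-x_l)$ converges to the closed ball of radius $r$ centred at the origin, that is, the distance of $e(t)$ to the ball tends to $0$. **Theorem.** 1. Tracking holds almost surely (whatever the laws of $\tau$ and of the noise). 2. Suppose in addition that the coordinates $\tau_k$ are independent samples of the Gaussian processes $\mathcal{GP}(0,\kappa_k)$, that almost surely each $\tau_k$ is Lipschitz on $\mathbb X$ with a (sample-dependent) constant $L_f$, and that the noise is i.i.d. $\mathcal N(0,\sigma_o^2)$ and independent of $\tau$. Let $\delta\in(0,1)$ and $\rho>0$,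 and put $\beta=2\log(N n/\delta)$, where $N$ is the $\rho$-covering number of $\mathbb X$. Then there is an event of probability at least $(1-\delta)^m$ on which tracking holds and, for all $i$, $k$ and all $x\in\mathbb X$, $$|\tau_k(x)-\tilde\mu_{ik}(x)|\le\sum_{j=1}^n w_{ik}^{jk}(x)\Big(\sqrt{\beta}\,\sigma_{jk}(x)+(L_f+L_{\mu_{jk}})\rho+\sqrt{\beta L_{\sigma_{jk}^2}\rho}\Big),$$ where $L_{\mu_{jk}}$ and $L_{\sigma^2_{jk}}$ are any Lipschitz constants of $\mu_{jk}$ and $\sigma_{jk}^2$ on $\mathbb X$. -/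

import Mathlib

open MeasureTheory ProbabilityTheory Filter Topology
open scoped NNReal

/-- The data of a leader-follower multi-agent system with `n` followers and `m`-dimensional states,
together with the data sets on which the followers train their Gaussian process models.
The drift `f` and the disturbance `h` are random functions on the probability space `Ω`.
This structure holds raw data only; all assumptions are stated separately. -/
structure LeaderFollowerMAS (n m : ℕ) (Ω : Type*) where
  /-- the communication graph of the followers -/
  G : SimpleGraph (Fin n)
  /-- the followers that are connected to the leader -/
  pinned : Finset (Fin n)
  /-- the state space -/
  X : Set (EuclideanSpace ℝ (Fin m))
  /-- the unknown dynamics of the followers -/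
  f : Ω → EuclideanSpace ℝ (Fin m) → EuclideanSpace ℝ (Fin m)
  /-- the unknown disturbance -/
  h : Ω → EuclideanSpace ℝ (Fin m) → EuclideanSpace ℝ (Fin m)
  /-- the dynamics of the leader -/
  fl : EuclideanSpace ℝ (Fin m) → ℝ → EuclideanSpace ℝ (Fin m)
  /-- the control gains -/
  gain : Fin n → ℝ
  /-- the covariance kernel used for each coordinate of the unknown dynamics -/
  κ : Fin m → EuclideanSpace ℝ (Fin m) → EuclideanSpace ℝ (Fin m) → ℝ
  /-- the variance of the observation noise -/
  noiseVar : ℝ≥0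
  /-- the number of training pairs of each follower -/
  M : Fin n → ℕ
  /-- the training inputs of each follower -/
  input : (j : Fin n) → Fin (M j) → X
  /-- the observation noise: agent, sample, coordinate -/
  noise : (j : Fin n) → Fin (M j) → Fin m → Ω → ℝ

namespace LeaderFollowerMAS

variable {n m : ℕ} {Ω : Type*} (S : LeaderFollowerMAS n m Ω)

/-! ### Communication graph -/

open Classical in
/-- The entries `a i j` of the adjacency matrix of the follower graph. -/
noncomputable def adj (i j : Fin n) : ℝ := S.G.adjMatrix ℝ i j

/-- The entry `b i` is `1` if follower `i` is connected to the leader and `0` otherwise. -/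
def b (i : Fin n) : ℝ := if i ∈ S.pinned then 1 else 0

open Classical in
/-- The matrix `L + B`. -/
noncomputable def Ltilde : Matrix (Fin n) (Fin n) ℝ :=
  S.G.lapMatrix ℝ + Matrix.diagonal S.b

/-- The smallest (real) eigenvalue of `L + B`. -/
noncomputable def lambdaMin : ℝ := sInf (spectrum ℝ S.Ltilde)

/-- The smallest control gain. -/
noncomputable def kStar : ℝ := ⨅ i, S.gain i

/-! ### Gaussian process regression -/

/-- The unknown dynamics to be predicted, `τ = f + h`. -/
def tau (ω : Ω) (x : EuclideanSpace ℝ (Fin m)) : EuclideanSpace ℝ (Fin m) :=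
  S.f ω x + S.h ω x

/-- The noisy training outputs of agent `j` for coordinate `k`. -/
def output (ω : Ω) (j : Fin n) (k : Fin m) (p : Fin (S.M j)) : ℝ :=
  S.tau ω (S.input j p) k + S.noise j p k ω

/-- The Gram matrix of the training inputs of agent `j` plus `σ_o² I`. -/
noncomputable def gram (j : Fin n) (k : Fin m) : Matrix (Fin (S.M j)) (Fin (S.M j)) ℝ :=
  Matrix.of (fun p q => S.κ k (S.input j p) (S.input j q)) + (S.noiseVar : ℝ) • 1

/-- The vector of kernel values between `x` and the training inputs of agent `j`. -/
def kvec (j : Fin n) (k : Fin m) (x : EuclideanSpace ℝ (Fin m)) (p : Fin (S.M j)) : ℝ :=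
  S.κ k x (S.input j p)

open Matrix in
/-- The posterior mean `μ_{jk}(x)` of agent `j` for coordinate `k`. -/
noncomputable def postMean (ω : Ω) (j : Fin n) (k : Fin m) (x : EuclideanSpace ℝ (Fin m)) : ℝ :=
  S.kvec j k x ⬝ᵥ ((S.gram j k)⁻¹ *ᵥ S.output ω j k)

open Matrix in
/-- The posterior variance `σ_{jk}²(x)` of agent `j` for coordinate `k`. -/
noncomputable def postVar (j : Fin n) (k : Fin m) (x : EuclideanSpace ℝ (Fin m)) : ℝ :=
  S.κ k x x - S.kvec j k x ⬝ᵥ ((S.gram j k)⁻¹ *ᵥ S.kvec j k x)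

/-- The fused precision `σ̃_{ik}⁻²(x)` of agent `i`. -/
noncomputable def fusedPrecision (i : Fin n) (k : Fin m) (x : EuclideanSpace ℝ (Fin m)) : ℝ :=
  (S.postVar i k x)⁻¹ + ∑ j, S.adj i j * (S.postVar j k x)⁻¹

/-- The weight `w_{ik}^{jk}(x)` that agent `i` gives to the prediction of agent `j`. -/
noncomputable def weight (i j : Fin n) (k : Fin m) (x : EuclideanSpace ℝ (Fin m)) : ℝ :=
  ((if j = i then 1 else 0) + S.adj i j) * (S.postVar j k x)⁻¹ / S.fusedPrecision i k x

/-- The distributed prediction `μ̃_i(x)` of agent `i`: the precision-weighted mean of the posterior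
means of agent `i` and its neighbours. -/
noncomputable def prediction (ω : Ω) (i : Fin n) (x : EuclideanSpace ℝ (Fin m)) :
    EuclideanSpace ℝ (Fin m) :=
  WithLp.toLp 2 fun k =>
    ((S.postVar i k x)⁻¹ * S.postMean ω i k x
      + ∑ j, S.adj i j * (S.postVar j k x)⁻¹ * S.postMean ω j k x) / S.fusedPrecision i k x

/-- The model error `Δτ(x) = ‖τ(x) - μ̃_i(x)‖` of agent `i`. -/
noncomputable def modelError (ω : Ω) (i : Fin n) (x : EuclideanSpace ℝ (Fin m)) : ℝ :=
  ‖S.tau ω x - S.prediction ω i x‖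

/-! ### Closed loop -/

/-- The consensus error `ξ_i` for follower states `x` and leader state `xl`. -/
noncomputable def consensusError (x : Fin n → EuclideanSpace ℝ (Fin m))
    (xl : EuclideanSpace ℝ (Fin m)) (i : Fin n) : EuclideanSpace ℝ (Fin m) :=
  ∑ j, S.adj i j • (x i - x j) + S.b i • (x i - xl)

/-- The distributed learning control law `u_i = -k_i ξ_i - μ̃_i(x_i)`. -/
noncomputable def control (ω : Ω) (x : Fin n → EuclideanSpace ℝ (Fin m))
    (xl : EuclideanSpace ℝ (Fin m)) (i : Fin n) : EuclideanSpace ℝ (Fin m) :=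
  -(S.gain i • S.consensusError x xl i) - S.prediction ω i (x i)

/-- `x` (followers) and `xl` (leader) are trajectories of the closed loop on `[0, ∞)` in the state
space, for the realization `ω`. -/
structure IsTrajectory (ω : Ω) (x : Fin n → ℝ → EuclideanSpace ℝ (Fin m))
    (xl : ℝ → EuclideanSpace ℝ (Fin m)) : Prop where
  mem : ∀ i, ∀ t, 0 ≤ t → x i t ∈ S.X
  leader_mem : ∀ t, 0 ≤ t → xl t ∈ S.X
  follower : ∀ i, ∀ t, 0 ≤ t → HasDerivWithinAt (x i)
    (S.f ω (x i t) + S.control ω (fun j => x j t) (xl t) i + S.h ω (x i t)) (Set.Ici 0) t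
  leader : ∀ t, 0 ≤ t → HasDerivWithinAt xl (S.fl (xl t) t) (Set.Ici 0) t

/-- The global tracking error `e = (x_1 - x_l, …, x_n - x_l)` with its Euclidean norm. -/
noncomputable def trackingError (x : Fin n → ℝ → EuclideanSpace ℝ (Fin m))
    (xl : ℝ → EuclideanSpace ℝ (Fin m)) (t : ℝ) :
    PiLp 2 (fun _ : Fin n => EuclideanSpace ℝ (Fin m)) :=
  WithLp.toLp 2 fun i => x i t - xl t

/-- The quantity `∑ i, (f̄_l² + ‖Δτ(x_i)‖²)` along the follower trajectories, at time `t`. -/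
noncomputable def nuAt (flbar : ℝ) (ω : Ω) (x : Fin n → ℝ → EuclideanSpace ℝ (Fin m))
    (t : ℝ) : ℝ :=
  ∑ i, (flbar ^ 2 + S.modelError ω i (x i t) ^ 2)

/-- The parameter `ν`: the ultimate value (limit superior as `t → ∞`) of
`∑ i, (f̄_l² + ‖Δτ(x_i)‖²)` along the trajectory. -/
noncomputable def nu (flbar : ℝ) (ω : Ω) (x : Fin n → ℝ → EuclideanSpace ℝ (Fin m)) : ℝ :=
  limsup (S.nuAt flbar ω x) atTop

/-- The radius `√(2 ν) / (k* λ_min(L + B))`. -/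
noncomputable def radius (flbar : ℝ) (ω : Ω) (x : Fin n → ℝ → EuclideanSpace ℝ (Fin m)) : ℝ :=
  √(2 * S.nu flbar ω x) / (S.kStar * S.lambdaMin)

/-- Practical consensus with the positive constant `c`: the superior limit of each
`‖x_i(t) - x_l(t)‖` as `t → ∞` is at most `c`. -/
def PracticalConsensus (x : Fin n → ℝ → EuclideanSpace ℝ (Fin m))
    (xl : ℝ → EuclideanSpace ℝ (Fin m)) (c : ℝ) : Prop :=
  0 < c ∧ ∀ i, ∀ ε > 0, ∀ᶠ t in atTop, ‖x i t - xl t‖ ≤ c + ε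

/-- The tracking guarantee for the realization `ω`: along every closed-loop trajectory, the quantity
defining `ν` is bounded (so that `ν` is a genuine limit superior), practical consensus
holds with the radius as constant, and the tracking error converges to the closed ball of that
radius centred at the origin. -/
def Tracks (flbar : ℝ) (ω : Ω) : Prop :=
  ∀ (x : Fin n → ℝ → EuclideanSpace ℝ (Fin m)) (xl : ℝ → EuclideanSpace ℝ (Fin m)),
    S.IsTrajectory ω x xl →
      IsBoundedUnder (· ≤ ·) atTop (S.nuAt flbar ω x) ∧
      PracticalConsensus x xl (S.radius flbar ω x) ∧
      Tendsto (fun t => Metric.infDist (trackingError x xl t)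
        (Metric.closedBall 0 (S.radius flbar ω x))) atTop (𝓝 0)

/-! ### Assumptions -/

/-- For almost every realization, `f` and `h` are bounded and continuously differentiable. -/
def SmoothBoundedDynamics [MeasurableSpace Ω] (P : Measure Ω) : Prop :=
  ∀ᵐ ω ∂P, ContDiffOn ℝ 1 (S.f ω) S.X ∧ ContDiffOn ℝ 1 (S.h ω) S.X ∧
    ∃ C : ℝ, ∀ x ∈ S.X, ‖S.f ω x‖ ≤ C ∧ ‖S.h ω x‖ ≤ C

/-- The leader dynamics is continuous and bounded by the positive constant `flbar`. -/
def BoundedLeader (flbar : ℝ) : Prop :=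
  0 < flbar ∧ ContinuousOn (fun q : EuclideanSpace ℝ (Fin m) × ℝ => S.fl q.1 q.2)
      (S.X ×ˢ Set.Ici 0) ∧
    ∀ x ∈ S.X, ∀ t, 0 ≤ t → ‖S.fl x t‖ < flbar

/-- The follower graph is connected and the leader is connected to at least one follower. -/
def ConnectedNetwork : Prop := S.G.Connected ∧ S.pinned.Nonempty

/-- Each `κ k` is a Lipschitz continuous covariance function with positive prior variance on the
state space, and the noise variance is positive. -/
def RegularKernel : Prop :=
  0 < S.noiseVar ∧
  ∀ k, (Matrix.of fun x y : S.X => S.κ k x y).PosSemidef ∧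
    (∀ x ∈ S.X, 0 < S.κ k x x) ∧
    ∃ Lk : ℝ≥0, LipschitzOnWith Lk
      (fun q : EuclideanSpace ℝ (Fin m) × EuclideanSpace ℝ (Fin m) => S.κ k q.1 q.2) (S.X ×ˢ S.X)

/-- Well-calibrated prior: the coordinates of the unknown dynamics are independent samples of
centred Gaussian processes with covariance functions `κ k`; the samples have the (sample-dependent)
Lipschitz constant `Lf ω`; the observation noise is i.i.d. centred Gaussian and independent of
the unknown dynamics. -/
structure IsGPSample [MeasurableSpace Ω] (P : Measure Ω) (Lf : Ω → ℝ≥0) : Prop where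
  measurable_tau : ∀ (k : Fin m) (x : S.X), Measurable fun ω => S.tau ω x k
  gaussian : ∀ k : Fin m, IsGaussianProcess (fun (x : S.X) (ω : Ω) => S.tau ω x k) P
  mean_zero : ∀ (k : Fin m) (x : S.X), ∫ ω, S.tau ω x k ∂P = 0
  covariance_eq : ∀ (k : Fin m) (x y : S.X),
    covariance (fun ω => S.tau ω x k) (fun ω => S.tau ω y k) P = S.κ k x y
  indep_coord : iIndepFun (fun (k : Fin m) (ω : Ω) (x : S.X) => S.tau ω x k) P
  lipschitz : ∀ᵐ ω ∂P, ∀ k : Fin m, LipschitzOnWith (Lf ω) (fun x => S.tau ω x k) S.X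
  measurable_noise : ∀ (j : Fin n) (p : Fin (S.M j)) (k : Fin m), Measurable (S.noise j p k)
  noise_law : ∀ (j : Fin n) (p : Fin (S.M j)) (k : Fin m),
    HasLaw (S.noise j p k) (gaussianReal 0 S.noiseVar) P
  noise_indep : iIndepFun
    (fun (q : (Σ j, Fin (S.M j)) × Fin m) (ω : Ω) => S.noise q.1.1 q.1.2 q.2 ω) P
  noise_indep_tau : IndepFun (fun (ω : Ω) (q : Fin m × S.X) => S.tau ω q.2 q.1)
    (fun (ω : Ω) (q : (Σ j, Fin (S.M j)) × Fin m) => S.noise q.1.1 q.1.2 q.2 ω) P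

/-! ### The probabilistic model error bound -/

/-- `β(ρ, δ) = 2 log (N(ρ) n / δ)`, where `N(ρ)` is the `ρ`-covering number of the state space. -/
noncomputable def beta (ρ : ℝ≥0) (δ : ℝ) : ℝ :=
  2 * Real.log (((Metric.coveringNumber ρ S.X).toNat : ℝ) * n / δ)

/-- For the realization `ω`, the model error of every agent satisfies, in every coordinate and
uniformly on the state space,
`|τ_k - μ̃_{ik}| ≤ ∑ j, w_{ik}^{jk} (√β σ_{jk} + γ_{jk})` with
`γ_{jk} = (L_f + L_{μ_{jk}}) ρ + √(β L_{σ_{jk}²} ρ)`, where `L_{μ_{jk}}` and `L_{σ_{jk}²}` are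
Lipschitz constants of the posterior mean and variance functions. -/
def ErrorBound (Lf : Ω → ℝ≥0) (ρ : ℝ≥0) (δ : ℝ) (ω : Ω) : Prop :=
  ∀ Lμ Lσ : Fin n → Fin m → ℝ≥0,
    (∀ j k, LipschitzOnWith (Lμ j k) (S.postMean ω j k) S.X) →
    (∀ j k, LipschitzOnWith (Lσ j k) (S.postVar j k) S.X) →
    ∀ (i : Fin n) (k : Fin m), ∀ x ∈ S.X,
      |S.tau ω x k - S.prediction ω i x k| ≤
        ∑ j, S.weight i j k x * (√(S.beta ρ δ) * √(S.postVar j k x)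
          + ((Lf ω + Lμ j k : ℝ) * ρ + √(S.beta ρ δ * Lσ j k * ρ)))

end LeaderFollowerMAS

/-! Tracking is deterministic once `f` and `h` are continuous. Write `M = L + B`, `ξ = M e`, `V =
⟨e, M e⟩`, where `M` is positive definite with least eigenvalue `λ`. Young's inequality gives `V' ≤
-k*‖ξ‖² + ‖d‖²/k*`, where `d` collects model error and leader velocity. Since `‖ξ‖² ≥ λV` and `‖d‖²
≤ 2ν(t)`, a Grönwall argument bounds `limsup V` by `2ν/(k*²λ)`, and `λ‖e‖² ≤ V` turns this into the
radius (`lyapunov_deriv_le`, `tracks`).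

For the error bound, the residual `τ_k(x) - μ_{jk}(x)` is linear in the prior process and the noise,
hence centred Gaussian, and its variance is exactly `σ_{jk}²(x)` (`map_residual`). A Gaussian tail
bound and a union over agents and the points of a `ρ`-net give accuracy on the net with probability
at least `1 - δ` per coordinate. Different coordinates use disjoint independent sources, so these
probabilities multiply. Lipschitz continuity passes from the net to the whole space, and the fused
prediction inherits the bound as a convex combination (`errorBound_of_accurate`). Removing the null
set where tracking or the Lipschitz property fails costs no probability. -/

/-! ### Gaussian tails -/

lemma gaussianPDFReal_add_le {v : ℝ≥0} {x r : ℝ} (hx : 0 ≤ x) (hr : 0 ≤ r) :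
    gaussianPDFReal 0 v (x + r) ≤ Real.exp (-r ^ 2 / (2 * v)) * gaussianPDFReal 0 v x := by
  rw [gaussianPDFReal, gaussianPDFReal, mul_left_comm, ← Real.exp_add, ← add_div]
  gcongr
  nlinarith [mul_nonneg hx hr]

/-- Shift the tail to the positive half-line and compare densities pointwise. Keeping the mass of
that half-line as a factor is what later avoids a constant 2 in the two-sided bound. -/
lemma gaussianReal_Ioi_le {v : ℝ≥0} (hv : v ≠ 0) {r : ℝ} (hr : 0 ≤ r) :
    gaussianReal 0 v (Set.Ioi r) ≤
      ENNReal.ofReal (Real.exp (-r ^ 2 / (2 * v))) * gaussianReal 0 v (Set.Ioi 0) := by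
  rw [gaussianReal_apply 0 hv, gaussianReal_apply 0 hv,
    ← lintegral_const_mul _ (measurable_gaussianPDF 0 v),
    ← lintegral_indicator measurableSet_Ioi, ← lintegral_indicator measurableSet_Ioi,
    ← lintegral_add_right_eq_self _ r]
  refine lintegral_mono fun x => ?_
  by_cases hx : 0 < x
  · rw [Set.indicator_of_mem (by simpa using hx), Set.indicator_of_mem (by simpa using hx),
      gaussianPDF, gaussianPDF, ← ENNReal.ofReal_mul (Real.exp_nonneg _)]
    exact ENNReal.ofReal_le_ofReal (gaussianPDFReal_add_le hx.le hr)
  · rw [Set.indicator_of_notMem (by simpa using hx)]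
    exact zero_le

lemma gaussianReal_Iio_neg (v : ℝ≥0) (r : ℝ) :
    gaussianReal 0 v (Set.Iio (-r)) = gaussianReal 0 v (Set.Ioi r) := by
  conv_lhs => rw [← neg_zero, ← gaussianReal_map_neg]
  rw [Measure.map_apply measurable_neg measurableSet_Iio]
  congr 1
  ext x
  simp

/-- The two-sided Gaussian tail bound with constant `1`. -/
lemma gaussianReal_abs_gt_le {v : ℝ≥0} (hv : v ≠ 0) {r : ℝ} (hr : 0 ≤ r) :
    gaussianReal 0 v {x | r < |x|} ≤ ENNReal.ofReal (Real.exp (-r ^ 2 / (2 * v))) := by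
  have h0 : gaussianReal 0 v (Set.Ioi 0) + gaussianReal 0 v (Set.Iio 0) ≤ 1 := by
    have hd : Disjoint (Set.Ioi (0 : ℝ)) (Set.Iio 0) :=
      Set.disjoint_left.2 fun x (hx : 0 < x) (hx' : x < 0) => hx.not_gt hx'
    rw [← measure_union hd measurableSet_Iio]
    exact prob_le_one
  have hs : {x : ℝ | r < |x|} = Set.Ioi r ∪ Set.Iio (-r) := by
    ext x
    simp [lt_abs, lt_neg]
  have h1 := gaussianReal_Iio_neg v 0
  rw [neg_zero] at h1
  calc gaussianReal 0 v {x | r < |x|}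
      ≤ gaussianReal 0 v (Set.Ioi r) + gaussianReal 0 v (Set.Iio (-r)) := by
        rw [hs]; exact measure_union_le _ _
    _ ≤ ENNReal.ofReal (Real.exp (-r ^ 2 / (2 * v))) *
        (gaussianReal 0 v (Set.Ioi 0) + gaussianReal 0 v (Set.Iio 0)) := by
        rw [gaussianReal_Iio_neg, h1, mul_add]
        exact add_le_add (gaussianReal_Ioi_le hv hr) (gaussianReal_Ioi_le hv hr)
    _ ≤ _ := mul_le_of_le_one_right' h0

/-! ### Independence of grouped σ-algebras -/

/-- Joins of independent σ-algebras over pairwise disjoint index sets are independent. -/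
lemma iIndep_iSup_of_pairwise_disjoint {Ω ι κ : Type*} [MeasurableSpace Ω] {P : Measure Ω}
    {m : ι → MeasurableSpace Ω} (hle : ∀ i, m i ≤ ‹MeasurableSpace Ω›) (hm : iIndep m P)
    {S : κ → Set ι} (hS : Pairwise (Function.onFun Disjoint S)) :
    iIndep (fun k => ⨆ i ∈ S k, m i) P := by
  classical
  have := hm.isProbabilityMeasure
  rw [iIndep_iff]
  intro s A hA
  induction s using Finset.induction_on with
  | empty => simp
  | insert a s ha ih =>
    rw [Finset.prod_insert ha, ← ih fun i hi => hA i (Finset.mem_insert_of_mem hi),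
      Finset.set_biInter_insert]
    -- The remaining events all lie in the join over `⋃ k ∈ s, S k`, so independence of two joins
    -- over disjoint sets suffices.
    have hd : Disjoint (S a) (⋃ k ∈ s, S k) := by
      simp only [Set.disjoint_iUnion_right]
      exact fun k hk => hS fun h => ha (h ▸ hk)
    refine (Indep_iff _ _ P).1 (indep_iSup_of_disjoint hle hm hd) _ _
      (hA a (Finset.mem_insert_self _ _)) ?_
    refine MeasurableSet.biInter s.countable_toSet fun k hk => ?_
    refine (?_ : (⨆ i ∈ S k, m i) ≤ _) _ (hA k (Finset.mem_insert_of_mem hk))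
    exact biSup_mono fun i hi => Set.mem_biUnion hk hi

/-- Two mutually independent families, each of independent random variables, form together an
independent family. -/
lemma iIndep_sumElim {Ω ι κ : Type*} [MeasurableSpace Ω] {P : Measure Ω}
    {m₁ : ι → MeasurableSpace Ω} {m₂ : κ → MeasurableSpace Ω}
    (h₁ : iIndep m₁ P) (h₂ : iIndep m₂ P) (h : Indep (⨆ i, m₁ i) (⨆ i, m₂ i) P) :
    iIndep (Sum.elim m₁ m₂) P := by
  rw [iIndep_iff]
  intro s A hA
  have hl : ∀ i ∈ s.toLeft, MeasurableSet[m₁ i] (A (.inl i)) := fun i hi =>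
    hA _ (Finset.mem_toLeft.1 hi)
  have hr : ∀ i ∈ s.toRight, MeasurableSet[m₂ i] (A (.inr i)) := fun i hi =>
    hA _ (Finset.mem_toRight.1 hi)
  have hi : ⋂ i ∈ s, A i = (⋂ i ∈ s.toLeft, A (.inl i)) ∩ ⋂ i ∈ s.toRight, A (.inr i) := by
    ext ω
    simp [Sum.forall]
  have hp : ∏ i ∈ s, P (A i) =
      (∏ i ∈ s.toLeft, P (A (.inl i))) * ∏ i ∈ s.toRight, P (A (.inr i)) := by
    conv_lhs => rw [← Finset.toLeft_disjSum_toRight (u := s)]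
    rw [Finset.prod_disjSum]
  rw [hi, hp, ← (iIndep_iff _ P).1 h₁ s.toLeft hl, ← (iIndep_iff _ P).1 h₂ s.toRight hr]
  refine (Indep_iff _ _ P).1 h _ _ ?_ ?_
  · exact Finset.measurableSet_biInter _ fun i hi => le_iSup m₁ i _ (hl i hi)
  · exact Finset.measurableSet_biInter _ fun i hi => le_iSup m₂ i _ (hr i hi)

/-! ### A Grönwall-type comparison -/

/-- If eventually `W' ≤ -a (W - C)`, then `W` is eventually below every level above `C`. -/
lemma eventually_le_add_of_deriv_le {W W' : ℝ → ℝ} {a C : ℝ} (ha : 0 < a)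
    (hW : ∀ᶠ t in atTop, HasDerivAt W (W' t) t) (hle : ∀ᶠ t in atTop, W' t ≤ -a * (W t - C))
    {ε : ℝ} (hε : 0 < ε) : ∀ᶠ t in atTop, W t ≤ C + ε := by
  obtain ⟨T, hT⟩ := eventually_atTop.1 (hW.and hle)
  -- Integrating factor: the differential inequality makes this product nonincreasing.
  have hd : ∀ t, T ≤ t → HasDerivAt (fun t => (W t - C) * Real.exp (a * t))
      (W' t * Real.exp (a * t) + (W t - C) * (Real.exp (a * t) * a)) t := fun t ht => by
    have h2 : HasDerivAt (fun t : ℝ => a * t) a t := by simpa using (hasDerivAt_id t).const_mul a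
    exact ((hT t ht).1.sub_const C).mul h2.exp
  have hanti : AntitoneOn (fun t => (W t - C) * Real.exp (a * t)) (Set.Ici T) := by
    refine antitoneOn_of_hasDerivWithinAt_nonpos (convex_Ici T)
      (fun t ht => (hd t ht).continuousAt.continuousWithinAt)
      (fun t ht => (hd t (interior_subset ht)).hasDerivWithinAt) fun t ht => ?_
    nlinarith [(hT t (interior_subset ht)).2, Real.exp_pos (a * t)]
  have hlim : Tendsto (fun t => (W T - C) * Real.exp (a * T) * Real.exp (-(a * t))) atTop (𝓝 0) := by
    simpa using (Real.tendsto_exp_neg_atTop_nhds_zero.comp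
      (tendsto_id.const_mul_atTop ha)).const_mul ((W T - C) * Real.exp (a * T))
  filter_upwards [hlim.eventually_le_const hε, eventually_ge_atTop T] with t h1 h2
  have h3 := hanti Set.self_mem_Ici h2 h2
  have h4 := mul_le_mul_of_nonneg_right h3 (Real.exp_nonneg (-(a * t)))
  rw [mul_assoc (W t - C), ← Real.exp_add, add_neg_cancel, Real.exp_zero, mul_one] at h4
  linarith

namespace LeaderFollowerMAS

variable {n m : ℕ} {Ω : Type*} {S : LeaderFollowerMAS n m Ω}

/-! ### The network -/

open Classical in
lemma Ltilde_apply (S : LeaderFollowerMAS n m Ω) (i j : Fin n) :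
    S.Ltilde i j = (if i = j then ∑ l, S.adj i l + S.b i else 0) - S.adj i j := by
  by_cases h : i = j
  · subst h
    simp [Ltilde, adj, SimpleGraph.lapMatrix, SimpleGraph.degMatrix, Matrix.diagonal,
      SimpleGraph.degree_eq_sum_if_adj (R := ℝ), SimpleGraph.adjMatrix_apply]
  · simp [Ltilde, adj, SimpleGraph.lapMatrix, SimpleGraph.degMatrix, Matrix.diagonal, h,
      SimpleGraph.adjMatrix_apply]

lemma adj_nonneg (S : LeaderFollowerMAS n m Ω) (i j : Fin n) : 0 ≤ S.adj i j := by
  classical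
  rw [adj, SimpleGraph.adjMatrix_apply]
  split_ifs <;> simp

lemma b_nonneg (S : LeaderFollowerMAS n m Ω) (i : Fin n) : 0 ≤ S.b i := by
  rw [b]
  split_ifs <;> simp

lemma consensusError_eq (S : LeaderFollowerMAS n m Ω) (x : Fin n → EuclideanSpace ℝ (Fin m))
    (xl : EuclideanSpace ℝ (Fin m)) (i : Fin n) :
    S.consensusError x xl i = ∑ j, S.Ltilde i j • (x j - xl) := by
  simp only [consensusError, Ltilde_apply, sub_smul, ite_smul, zero_smul, Finset.sum_sub_distrib,
    Finset.sum_ite_eq, Finset.mem_univ, if_true, add_smul, Finset.sum_smul]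
  rw [add_sub_right_comm, ← Finset.sum_sub_distrib]
  congr 1
  refine Finset.sum_congr rfl fun j _ => ?_
  rw [← smul_sub, sub_sub_sub_cancel_right]

/-- Both summands are positive semidefinite. If both quadratic forms vanish at `x`, connectedness
makes `x` constant, and a pinned follower makes the constant zero. -/
lemma Ltilde_posDef (h : S.ConnectedNetwork) : S.Ltilde.PosDef := by
  classical
  obtain ⟨hG, p, hp⟩ := h
  have hB : (Matrix.diagonal S.b).PosSemidef := Matrix.PosSemidef.diagonal S.b_nonneg
  have hL := S.G.posSemidef_lapMatrix ℝ
  refine Matrix.PosDef.of_dotProduct_mulVec_pos (hL.add hB).isHermitian fun x hx => ?_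
  have h1 := hL.dotProduct_mulVec_nonneg x
  have h2 := hB.dotProduct_mulVec_nonneg x
  rw [Ltilde, Matrix.add_mulVec, dotProduct_add]
  refine (add_nonneg h1 h2).lt_of_ne fun h0 => hx ?_
  obtain ⟨h3, h4⟩ := (add_eq_zero_iff_of_nonneg h1 h2).1 h0.symm
  have hr := (S.G.lapMatrix_toLinearMap₂'_apply'_eq_zero_iff_forall_reachable x).1
    (by simpa [Matrix.toLinearMap₂'_apply'] using h3)
  have hxp : x p = 0 := by
    simp only [dotProduct, Matrix.mulVec_diagonal, star_trivial] at h4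
    rw [Finset.sum_eq_zero_iff_of_nonneg fun i _ => by
      nlinarith [mul_nonneg (S.b_nonneg i) (mul_self_nonneg (x i))]] at h4
    simpa [b, hp] using h4 p (Finset.mem_univ p)
  funext i
  exact (hr i p (hG.preconnected i p)).trans hxp

lemma lambdaMin_mem (h : S.ConnectedNetwork) : S.lambdaMin ∈ spectrum ℝ S.Ltilde := by
  have := h.1.nonempty
  have hH := (Ltilde_posDef h).isHermitian
  rw [lambdaMin, hH.spectrum_real_eq_range_eigenvalues]
  exact (Set.range_nonempty _).csInf_mem (Set.finite_range _)

lemma lambdaMin_pos (h : S.ConnectedNetwork) : 0 < S.lambdaMin := by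
  have hm := lambdaMin_mem h
  rw [(Ltilde_posDef h).isHermitian.spectrum_real_eq_range_eigenvalues] at hm
  obtain ⟨i, hi⟩ := hm
  exact hi ▸ (Ltilde_posDef h).eigenvalues_pos i

/-- Rayleigh bound: subtracting `λ` times the identity shifts the spectrum to the nonnegative reals.
-/
lemma lambdaMin_mul_le (h : S.ConnectedNetwork) (x : Fin n → ℝ) :
    S.lambdaMin * ∑ i, x i ^ 2 ≤ ∑ i, ∑ j, S.Ltilde i j * (x i * x j) := by
  have hH := (Ltilde_posDef h).isHermitian
  have hpsd : (S.Ltilde - S.lambdaMin • (1 : Matrix (Fin n) (Fin n) ℝ)).PosSemidef := by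
    rw [Matrix.posSemidef_iff_isHermitian_and_spectrum_nonneg]
    refine ⟨hH.sub (by simp [Matrix.IsHermitian]), fun a ha => ?_⟩
    have h1 : a + S.lambdaMin ∈ spectrum ℝ S.Ltilde := by
      have := spectrum.add_mem_add_iff (R := ℝ) (a := S.Ltilde - S.lambdaMin • 1) (r := a)
        (s := S.lambdaMin)
      rw [Algebra.algebraMap_eq_smul_one, add_sub_cancel] at this
      exact this.2 ha
    have h2 : BddBelow (spectrum ℝ S.Ltilde) := by
      rw [hH.spectrum_real_eq_range_eigenvalues]
      exact (Set.finite_range _).bddBelow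
    have h3 : S.lambdaMin ≤ _ := csInf_le h2 h1
    simpa using h3
  have h1 := hpsd.dotProduct_mulVec_nonneg x
  simp only [Matrix.sub_mulVec, dotProduct_sub, Matrix.smul_mulVec, Matrix.one_mulVec,
    dotProduct_smul, smul_eq_mul, star_trivial, sub_nonneg] at h1
  simp only [dotProduct, Matrix.mulVec, Finset.mul_sum] at h1 ⊢
  convert! h1 using 3 with i _ i _ j _ <;> ring

lemma lambdaMin_mul_norm_le (h : S.ConnectedNetwork) (e : Fin n → EuclideanSpace ℝ (Fin m)) :
    S.lambdaMin * ∑ i, ‖e i‖ ^ 2 ≤ ∑ i, ∑ j, S.Ltilde i j * inner ℝ (e i) (e j) := by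
  have h1 := Finset.sum_le_sum fun (k : Fin m) (_ : k ∈ Finset.univ) =>
    lambdaMin_mul_le h fun i => e i k
  calc S.lambdaMin * ∑ i, ‖e i‖ ^ 2 = ∑ k, S.lambdaMin * ∑ i, e i k ^ 2 := by
        rw [← Finset.mul_sum, Finset.sum_comm]
        simp [EuclideanSpace.norm_sq_eq]
    _ ≤ _ := h1
    _ = _ := by
        rw [Finset.sum_comm]
        refine Finset.sum_congr rfl fun i _ => ?_
        rw [Finset.sum_comm]
        refine Finset.sum_congr rfl fun j _ => ?_
        simp [PiLp.inner_apply, Finset.mul_sum, mul_comm]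

/-- Expand `0 ≤ ‖λe - Me‖²` and use `λ²‖e‖² ≤ λ⟨e, Me⟩`; no square root of `M` is needed. -/
lemma lambdaMin_mul_form_le (h : S.ConnectedNetwork) (e : Fin n → EuclideanSpace ℝ (Fin m)) :
    S.lambdaMin * ∑ i, ∑ j, S.Ltilde i j * inner ℝ (e i) (e j) ≤
      ∑ i, ‖∑ j, S.Ltilde i j • e j‖ ^ 2 := by
  have h1 := lambdaMin_mul_norm_le h e
  have hl := lambdaMin_pos h
  have h2 : ∀ i, 0 ≤ ‖S.lambdaMin • e i - ∑ j, S.Ltilde i j • e j‖ ^ 2 := fun i => sq_nonneg _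
  have h3 : 0 ≤ ∑ i, ‖S.lambdaMin • e i - ∑ j, S.Ltilde i j • e j‖ ^ 2 :=
    Finset.sum_nonneg fun i _ => h2 i
  have h4 : ∑ i, ‖S.lambdaMin • e i - ∑ j, S.Ltilde i j • e j‖ ^ 2 =
      S.lambdaMin ^ 2 * ∑ i, ‖e i‖ ^ 2 -
        2 * (S.lambdaMin * ∑ i, ∑ j, S.Ltilde i j * inner ℝ (e i) (e j)) +
        ∑ i, ‖∑ j, S.Ltilde i j • e j‖ ^ 2 := by
    simp only [Finset.mul_sum, ← Finset.sum_sub_distrib, ← Finset.sum_add_distrib]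
    refine Finset.sum_congr rfl fun i _ => ?_
    rw [norm_sub_sq_real, norm_smul, inner_sum, mul_pow, Real.norm_eq_abs, sq_abs, Finset.mul_sum]
    simp only [inner_smul_left, inner_smul_right, RCLike.conj_to_real,
      mul_left_comm (S.Ltilde i _)]
  nlinarith [mul_le_mul_of_nonneg_left h1 hl.le]

lemma Ltilde_symm (h : S.ConnectedNetwork) (i j : Fin n) : S.Ltilde i j = S.Ltilde j i := by
  simpa using (Ltilde_posDef h).isHermitian.apply j i

lemma kStar_le (S : LeaderFollowerMAS n m Ω) (i : Fin n) : S.kStar ≤ S.gain i :=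
  ciInf_le (Set.finite_range _).bddBelow i

lemma kStar_pos (h : S.ConnectedNetwork) (hg : ∀ i, 0 < S.gain i) : 0 < S.kStar := by
  have := h.1.nonempty
  obtain ⟨i, hi⟩ := exists_eq_ciInf_of_finite (f := S.gain)
  rw [kStar, ← hi]
  exact hg i

end LeaderFollowerMAS

namespace LeaderFollowerMAS

variable {n m : ℕ} {Ω : Type*} {S : LeaderFollowerMAS n m Ω}

/-! ### The posterior -/

open Matrix

/-- The weights `(K + σ_o² I)⁻¹ k(x)` of the outputs in the posterior mean. -/
noncomputable def outputWeight (S : LeaderFollowerMAS n m Ω) (j : Fin n) (k : Fin m)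
    (x : EuclideanSpace ℝ (Fin m)) : Fin (S.M j) → ℝ :=
  (S.gram j k)⁻¹ *ᵥ S.kvec j k x

lemma gram_posDef (h : S.RegularKernel) (j : Fin n) (k : Fin m) : (S.gram j k).PosDef :=
  Matrix.PosDef.posSemidef_add ((h.2 k).1.submatrix (S.input j))
    (Matrix.PosDef.one.smul (NNReal.coe_pos.2 h.1))

/-- The inverse Gram matrix is symmetric, so it can act on the kernel vector instead. The mean
becomes linear in the outputs with deterministic weights. -/
lemma postMean_eq (h : S.RegularKernel) (ω : Ω) (j : Fin n) (k : Fin m)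
    (x : EuclideanSpace ℝ (Fin m)) :
    S.postMean ω j k x = ∑ p, S.outputWeight j k x p * S.output ω j k p := by
  have hs : ((S.gram j k)⁻¹)ᵀ = (S.gram j k)⁻¹ := by
    simpa [Matrix.IsHermitian, conjTranspose_eq_transpose_of_trivial] using
      (gram_posDef h j k).isHermitian.inv
  rw [postMean, dotProduct_mulVec, ← mulVec_transpose, hs]
  rfl

lemma gram_mulVec_outputWeight (h : S.RegularKernel) (j : Fin n) (k : Fin m)
    (x : EuclideanSpace ℝ (Fin m)) : S.gram j k *ᵥ S.outputWeight j k x = S.kvec j k x := by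
  rw [outputWeight, mulVec_mulVec, mul_nonsing_inv _ ((gram_posDef h j k).isUnit.map detMonoidHom),
    one_mulVec]

lemma kernel_symm (h : S.RegularKernel) (k : Fin m) (x y : S.X) : S.κ k x y = S.κ k y x := by
  simpa using (h.2 k).1.isHermitian.apply y x

/-- The coefficients of the prior part of the prediction residual at a point. -/
noncomputable def residualCoeff (S : LeaderFollowerMAS n m Ω) (j : Fin n) (k : Fin m)
    (x : EuclideanSpace ℝ (Fin m)) : Option (Fin (S.M j)) → ℝ :=
  fun o => o.elim 1 fun p => -S.outputWeight j k x p

/-- The points that enter the prediction residual at `x`. -/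
def residualPoint (S : LeaderFollowerMAS n m Ω) (j : Fin n) (x : S.X) :
    Option (Fin (S.M j)) → S.X :=
  fun o => o.elim x (S.input j)

/-- With `α` the output weights, the right side is `κ(x,x) - 2α·k + αᵀKα + σ_o²‖α‖²`, the variance
of the residual. The normal equation `(K + σ_o²I)α = k` collapses it to `κ(x,x) - α·k`. -/
lemma postVar_eq_residual (h : S.RegularKernel) (j : Fin n) (k : Fin m) (x : S.X) :
    S.postVar j k x = (∑ o, ∑ o', S.residualCoeff j k x o * S.residualCoeff j k x o' *
        S.κ k (S.residualPoint j x o) (S.residualPoint j x o'))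
      + S.noiseVar * ∑ p, S.outputWeight j k x p ^ 2 := by
  have h1 : ∀ p, ∑ q, S.κ k (S.input j p) (S.input j q) * S.outputWeight j k x q
      + S.noiseVar * S.outputWeight j k x p = S.κ k x (S.input j p) := fun p => by
    have := congrFun (gram_mulVec_outputWeight h j k x) p
    simpa [gram, add_mulVec, smul_mulVec, mulVec, dotProduct, kvec, Matrix.one_apply,
      add_mul, Finset.sum_add_distrib] using this
  have h2 : ∑ p, S.outputWeight j k x p * (∑ q, S.κ k (S.input j p) (S.input j q) *
      S.outputWeight j k x q + S.noiseVar * S.outputWeight j k x p) =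
      ∑ p, S.outputWeight j k x p * S.κ k x (S.input j p) :=
    Finset.sum_congr rfl fun p _ => by rw [h1]
  simp only [mul_add, Finset.sum_add_distrib, Finset.mul_sum] at h2
  have h3 : S.postVar j k x = S.κ k x x - ∑ p, S.outputWeight j k x p * S.κ k x (S.input j p) := by
    rw [postVar, dotProduct_comm]
    rfl
  simp only [h3, Fintype.sum_option, residualCoeff, residualPoint, Option.elim, Finset.mul_sum,
    Finset.sum_add_distrib, one_mul, mul_one, neg_mul, mul_neg,
    Finset.sum_neg_distrib, fun p => kernel_symm h k (S.input j p) x]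
  have h4 : ∑ p, ∑ q, S.outputWeight j k x p * S.outputWeight j k x q *
      S.κ k (S.input j p) (S.input j q) = ∑ p, ∑ q, S.outputWeight j k x p *
        (S.κ k (S.input j p) (S.input j q) * S.outputWeight j k x q) :=
    Finset.sum_congr rfl fun p _ => Finset.sum_congr rfl fun q _ => by ring
  have h5 : ∑ p, S.outputWeight j k x p * (S.noiseVar * S.outputWeight j k x p) =
      ∑ p, S.noiseVar * S.outputWeight j k x p ^ 2 :=
    Finset.sum_congr rfl fun p _ => by ring
  linarith

/-- If the output weights vanish, the prior variance remains; otherwise the noise term is already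
positive. -/
lemma postVar_pos (h : S.RegularKernel) (j : Fin n) (k : Fin m) (x : S.X) :
    0 < S.postVar j k x := by
  have h1 : 0 ≤ ∑ o, ∑ o', S.residualCoeff j k x o * S.residualCoeff j k x o' *
        S.κ k (S.residualPoint j x o) (S.residualPoint j x o') := by
    have := ((h.2 k).1.submatrix (S.residualPoint j x)).dotProduct_mulVec_nonneg
      (S.residualCoeff j k x)
    simp only [dotProduct, mulVec, Finset.mul_sum, star_trivial, submatrix_apply, of_apply] at this
    exact this.trans_eq (Finset.sum_congr rfl fun o _ => Finset.sum_congr rfl fun o' _ => by ring)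
  rw [postVar_eq_residual h]
  by_cases h0 : S.outputWeight j k x = 0
  · simpa [Fintype.sum_option, residualCoeff, residualPoint, h0] using (h.2 k).2.1 x x.2
  · obtain ⟨p, hp⟩ := Function.ne_iff.1 h0
    have h2 : 0 < ∑ p, S.outputWeight j k x p ^ 2 :=
      Finset.sum_pos' (fun _ _ => sq_nonneg _) ⟨p, Finset.mem_univ p, sq_pos_of_ne_zero hp⟩
    have h3 := NNReal.coe_pos.2 h.1
    positivity

lemma fusedPrecision_pos (h : S.RegularKernel) (i : Fin n) (k : Fin m) (x : S.X) :
    0 < S.fusedPrecision i k x :=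
  add_pos_of_pos_of_nonneg (inv_pos.2 (postVar_pos h i k x)) (Finset.sum_nonneg fun j _ =>
    mul_nonneg (S.adj_nonneg i j) (inv_nonneg.2 (postVar_pos h j k x).le))

lemma weight_nonneg (h : S.RegularKernel) (i j : Fin n) (k : Fin m) (x : S.X) :
    0 ≤ S.weight i j k x := by
  refine div_nonneg (mul_nonneg (add_nonneg ?_ (S.adj_nonneg i j))
    (inv_nonneg.2 (postVar_pos h j k x).le)) (fusedPrecision_pos h i k x).le
  split_ifs <;> simp

lemma sum_weight (h : S.RegularKernel) (i : Fin n) (k : Fin m) (x : S.X) :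
    ∑ j, S.weight i j k x = 1 := by
  simp only [weight, ← Finset.sum_div]
  rw [div_eq_one_iff_eq (fusedPrecision_pos h i k x).ne']
  simp [fusedPrecision, add_mul, Finset.sum_add_distrib]

lemma prediction_eq_sum_weight (S : LeaderFollowerMAS n m Ω) (ω : Ω) (i : Fin n) (k : Fin m)
    (x : EuclideanSpace ℝ (Fin m)) :
    S.prediction ω i x k = ∑ j, S.weight i j k x * S.postMean ω j k x := by
  simp only [prediction, weight, div_mul_eq_mul_div, ← Finset.sum_div, add_mul,
    Finset.sum_add_distrib, ite_mul, one_mul, zero_mul, Finset.sum_ite_eq', Finset.mem_univ,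
    if_true]

lemma continuousOn_kvec (h : S.RegularKernel) (j : Fin n) (k : Fin m) :
    ContinuousOn (S.kvec j k) S.X := by
  obtain ⟨-, -, Lk, hL⟩ := h.2 k
  exact continuousOn_pi.2 fun p => hL.continuousOn.comp
    (continuousOn_id.prodMk continuousOn_const) fun x hx => ⟨hx, (S.input j p).2⟩

lemma continuousOn_postMean (h : S.RegularKernel) (ω : Ω) (j : Fin n) (k : Fin m) :
    ContinuousOn (S.postMean ω j k) S.X := by
  have h1 := continuousOn_pi.1 (continuousOn_kvec h j k)
  simp only [funext fun x => show S.postMean ω j k x = ∑ p, S.kvec j k x p * _ from rfl]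
  exact continuousOn_finsetSum _ fun p _ => (h1 p).mul continuousOn_const

lemma continuousOn_postVar (h : S.RegularKernel) (j : Fin n) (k : Fin m) :
    ContinuousOn (S.postVar j k) S.X := by
  have h1 := continuousOn_pi.1 (continuousOn_kvec h j k)
  obtain ⟨-, -, Lk, hL⟩ := h.2 k
  refine (hL.continuousOn.comp (continuousOn_id.prodMk continuousOn_id)
    fun x hx => ⟨hx, hx⟩).sub (continuousOn_finsetSum _ fun p _ => (h1 p).mul ?_)
  simp only [mulVec, dotProduct]
  exact continuousOn_finsetSum _ fun q _ => continuousOn_const.mul (h1 q)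

lemma continuousOn_prediction (h : S.RegularKernel) (ω : Ω) (i : Fin n) :
    ContinuousOn (S.prediction ω i) S.X := by
  have hv : ∀ j k, ContinuousOn (fun x => (S.postVar j k x)⁻¹) S.X := fun j k =>
    (continuousOn_postVar h j k).inv₀ fun x hx => (postVar_pos h j k ⟨x, hx⟩).ne'
  refine (PiLp.continuous_toLp 2 _).comp_continuousOn (continuousOn_pi.2 fun k => ?_)
  refine ContinuousOn.div (((hv i k).mul (continuousOn_postMean h ω i k)).add
    (continuousOn_finsetSum _ fun j _ =>
      (continuousOn_const.mul (hv j k)).mul (continuousOn_postMean h ω j k)))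
    ((hv i k).add (continuousOn_finsetSum _ fun j _ => continuousOn_const.mul (hv j k)))
    fun x hx => (fusedPrecision_pos h i k ⟨x, hx⟩).ne'

end LeaderFollowerMAS

namespace LeaderFollowerMAS

variable {n m : ℕ} {Ω : Type*} {S : LeaderFollowerMAS n m Ω}

/-! ### Tracking -/

/-- The Lyapunov function `⟨e, (L + B) e⟩` of the tracking error `e`. -/
noncomputable def lyapunov (S : LeaderFollowerMAS n m Ω)
    (e : Fin n → EuclideanSpace ℝ (Fin m)) : ℝ :=
  ∑ i, ∑ j, S.Ltilde i j * inner ℝ (e i) (e j)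

lemma hasDerivAt_lyapunov (h : S.ConnectedNetwork) {e : Fin n → ℝ → EuclideanSpace ℝ (Fin m)}
    {e' : Fin n → EuclideanSpace ℝ (Fin m)} {t : ℝ} (he : ∀ i, HasDerivAt (e i) (e' i) t) :
    HasDerivAt (fun s => S.lyapunov fun i => e i s)
      (2 * ∑ i, inner ℝ (∑ j, S.Ltilde i j • e j t) (e' i)) t := by
  have h1 : HasDerivAt (fun s => S.lyapunov fun i => e i s) (∑ i, ∑ j, S.Ltilde i j *
      (inner ℝ (e i t) (e' j) + inner ℝ (e' i) (e j t))) t :=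
    HasDerivAt.fun_sum fun i _ => HasDerivAt.fun_sum fun j _ =>
      ((he i).inner ℝ (he j)).const_mul _
  convert! h1 using 1
  simp only [mul_add, Finset.sum_add_distrib, sum_inner, inner_smul_left, RCLike.conj_to_real]
  rw [two_mul]
  congr 1
  · rw [Finset.sum_comm]
    exact Finset.sum_congr rfl fun i _ => Finset.sum_congr rfl fun j _ => by rw [Ltilde_symm h]
  · exact Finset.sum_congr rfl fun i _ => Finset.sum_congr rfl fun j _ => by rw [real_inner_comm]

/-- Young's inequality with weight `k` spends half of the damping `2k‖ξ‖²` on the disturbance `d`.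
-/
lemma two_inner_le {E : Type*} [NormedAddCommGroup E] [InnerProductSpace ℝ E] (ξ d : E) {g k : ℝ}
    (hk : 0 < k) (hg : k ≤ g) :
    2 * inner ℝ ξ (-(g • ξ) + d) ≤ -k * ‖ξ‖ ^ 2 + ‖d‖ ^ 2 / k := by
  have h1 : inner ℝ ξ (-(g • ξ) + d) = -g * ‖ξ‖ ^ 2 + inner ℝ ξ d := by
    rw [inner_add_right, inner_neg_right, inner_smul_right, real_inner_self_eq_norm_sq]
    ring
  have h2 : 2 * inner ℝ ξ d ≤ k * ‖ξ‖ ^ 2 + ‖d‖ ^ 2 / k := by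
    have h3 := real_inner_le_norm ξ d
    have h4 : k * ‖ξ‖ ^ 2 + ‖d‖ ^ 2 / k - 2 * (‖ξ‖ * ‖d‖) = (k * ‖ξ‖ - ‖d‖) ^ 2 / k := by
      field_simp
      ring
    have h5 : 0 ≤ (k * ‖ξ‖ - ‖d‖) ^ 2 / k := by positivity
    linarith
  have h6 := mul_le_mul_of_nonneg_right hg (sq_nonneg ‖ξ‖)
  rw [h1]
  linarith

lemma IsTrajectory.lyapunov_deriv_le {ω : Ω} {x : Fin n → ℝ → EuclideanSpace ℝ (Fin m)}
    {xl : ℝ → EuclideanSpace ℝ (Fin m)} (hx : S.IsTrajectory ω x xl) (h : S.ConnectedNetwork)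
    (hg : ∀ i, 0 < S.gain i) {flbar : ℝ} (hl : S.BoundedLeader flbar) {t : ℝ} (ht : 0 < t) :
    ∃ V' : ℝ, HasDerivAt (fun s => S.lyapunov fun i => x i s - xl s) V' t ∧
      V' ≤ -(S.kStar * S.lambdaMin) * S.lyapunov (fun i => x i t - xl t)
        + 2 * S.nuAt flbar ω x t / S.kStar := by
  have hk := kStar_pos h hg
  set ξ : Fin n → EuclideanSpace ℝ (Fin m) := fun i => ∑ j, S.Ltilde i j • (x j t - xl t) with hξ
  set d : Fin n → EuclideanSpace ℝ (Fin m) := fun i =>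
    S.tau ω (x i t) - S.prediction ω i (x i t) - S.fl (xl t) t with hd
  have he : ∀ i, HasDerivAt (fun s => x i s - xl s) (-(S.gain i • ξ i) + d i) t := fun i => by
    have h1 := ((hx.follower i t ht.le).hasDerivAt (Ici_mem_nhds ht)).sub
      ((hx.leader t ht.le).hasDerivAt (Ici_mem_nhds ht))
    refine h1.congr_deriv ?_
    simp only [control, consensusError_eq, hd, hξ, tau]
    abel
  refine ⟨_, hasDerivAt_lyapunov h he, ?_⟩
  -- `(a + b)² ≤ 2(a² + b²)` is the source of the factor 2 under the root in the radius.
  have hdn : ∀ i, ‖d i‖ ^ 2 ≤ 2 * (flbar ^ 2 + S.modelError ω i (x i t) ^ 2) := fun i => by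
    have h1 : ‖d i‖ ≤ S.modelError ω i (x i t) + flbar :=
      (norm_sub_le _ _).trans (add_le_add le_rfl (hl.2.2 _ (hx.leader_mem t ht.le) t ht.le).le)
    nlinarith [norm_nonneg (d i), sq_nonneg (S.modelError ω i (x i t) - flbar),
      pow_le_pow_left₀ (norm_nonneg (d i)) h1 2]
  have hdiss : S.lambdaMin * S.lyapunov (fun i => x i t - xl t) ≤ ∑ i, ‖ξ i‖ ^ 2 :=
    lambdaMin_mul_form_le h _
  calc 2 * ∑ i, inner ℝ (ξ i) (-(S.gain i • ξ i) + d i)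
      ≤ ∑ i, (-S.kStar * ‖ξ i‖ ^ 2 + ‖d i‖ ^ 2 / S.kStar) := by
        rw [Finset.mul_sum]
        exact Finset.sum_le_sum fun i _ => two_inner_le _ _ hk (S.kStar_le i)
    _ = -S.kStar * ∑ i, ‖ξ i‖ ^ 2 + (∑ i, ‖d i‖ ^ 2) / S.kStar := by
        rw [Finset.sum_add_distrib, Finset.mul_sum, Finset.sum_div]
    _ ≤ -S.kStar * (S.lambdaMin * S.lyapunov (fun i => x i t - xl t))
        + 2 * S.nuAt flbar ω x t / S.kStar := by
        refine add_le_add (mul_le_mul_of_nonpos_left hdiss (neg_nonpos.2 hk.le)) ?_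
        gcongr
        rw [nuAt, Finset.mul_sum]
        exact Finset.sum_le_sum fun i _ => hdn i
    _ = _ := by ring

lemma exists_nuAt_le (hX : IsCompact S.X) (hker : S.RegularKernel) (flbar : ℝ) {ω : Ω}
    (hf : ContinuousOn (S.f ω) S.X) (hh : ContinuousOn (S.h ω) S.X)
    {x : Fin n → ℝ → EuclideanSpace ℝ (Fin m)} (hx : ∀ i, ∀ t, 0 ≤ t → x i t ∈ S.X) :
    ∃ C, ∀ t, 0 ≤ t → S.nuAt flbar ω x t ≤ C := by
  have h1 : ∀ i, ∃ C, ∀ y ∈ S.X, S.modelError ω i y ≤ C := fun i => by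
    obtain ⟨C, hC⟩ := hX.exists_bound_of_continuousOn
      ((hf.add hh).sub (continuousOn_prediction hker ω i))
    exact ⟨C, hC⟩
  choose C hC using h1
  refine ⟨∑ i, (flbar ^ 2 + C i ^ 2), fun t ht => Finset.sum_le_sum fun i _ => ?_⟩
  gcongr
  · exact norm_nonneg _
  · exact hC i _ (hx i t ht)

lemma card_mul_sq_le_nuAt (S : LeaderFollowerMAS n m Ω) (flbar : ℝ) (ω : Ω)
    (x : Fin n → ℝ → EuclideanSpace ℝ (Fin m)) (t : ℝ) :
    n * flbar ^ 2 ≤ S.nuAt flbar ω x t := by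
  calc (n : ℝ) * flbar ^ 2 = ∑ _i : Fin n, flbar ^ 2 := by simp
    _ ≤ _ := Finset.sum_le_sum fun i _ => le_add_of_nonneg_right (sq_nonneg _)

theorem tracks (hX : IsCompact S.X) {flbar : ℝ} (hleader : S.BoundedLeader flbar)
    (hnet : S.ConnectedNetwork) (hker : S.RegularKernel) (hgain : ∀ i, 0 < S.gain i) {ω : Ω}
    (hf : ContinuousOn (S.f ω) S.X) (hh : ContinuousOn (S.h ω) S.X) : S.Tracks flbar ω := by
  intro x xl hx
  have hk := kStar_pos hnet hgain
  have hlam := lambdaMin_pos hnet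
  have hn : (0 : ℝ) < n := by
    have := hnet.1.nonempty
    exact_mod_cast Fin.pos_iff_nonempty.2 this
  obtain ⟨C, hC⟩ := exists_nuAt_le hX hker flbar hf hh hx.mem
  have hbdd : IsBoundedUnder (· ≤ ·) atTop (S.nuAt flbar ω x) :=
    isBoundedUnder_of_eventually_le ((eventually_ge_atTop 0).mono hC)
  -- The leader bound alone contributes `n f̄_l² > 0`, which makes the radius positive.
  have hν : 0 < S.nu flbar ω x :=
    lt_of_lt_of_le (mul_pos hn (pow_pos hleader.1 2)) (le_limsup_of_le hbdd fun b hb =>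
      (hb.exists.elim fun t ht => (card_mul_sq_le_nuAt S flbar ω x t).trans ht))
  set r := S.radius flbar ω x with hr
  have hr0 : 0 < r := div_pos (Real.sqrt_pos.2 (by positivity)) (by positivity)
  have hr2 : r ^ 2 = 2 * S.nu flbar ω x / (S.kStar * S.lambdaMin) ^ 2 := by
    rw [hr, radius, div_pow, Real.sq_sqrt (by positivity)]
  have hlyap : ∀ ε > 0, ∀ᶠ t in atTop, S.lyapunov (fun i => x i t - xl t) ≤
      2 * (S.nu flbar ω x + ε) / (S.kStar ^ 2 * S.lambdaMin) + ε := fun ε hε => by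
    have hder : ∀ t, ∃ V' : ℝ, 0 < t →
        HasDerivAt (fun s => S.lyapunov fun i => x i s - xl s) V' t ∧
        V' ≤ -(S.kStar * S.lambdaMin) * S.lyapunov (fun i => x i t - xl t)
          + 2 * S.nuAt flbar ω x t / S.kStar := fun t => by
      by_cases ht : 0 < t
      · obtain ⟨V', hV⟩ := hx.lyapunov_deriv_le hnet hgain hleader ht
        exact ⟨V', fun _ => hV⟩
      -- A dummy derivative for `t ≤ 0`, so that one function `V'` can be chosen.
      · exact ⟨0, fun h => absurd h ht⟩
    choose V' hV' using hder
    refine eventually_le_add_of_deriv_le (mul_pos hk hlam)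
      ((eventually_gt_atTop 0).mono fun t ht => (hV' t ht).1) ?_ hε
    filter_upwards [eventually_gt_atTop 0, eventually_lt_of_limsup_lt
      (show limsup (S.nuAt flbar ω x) atTop < S.nu flbar ω x + ε from lt_add_of_pos_right _ hε)
      hbdd] with t ht hνt
    refine (hV' t ht).2.trans ?_
    rw [mul_sub, sub_eq_add_neg]
    gcongr
    rw [show -(-(S.kStar * S.lambdaMin) *
      (2 * (S.nu flbar ω x + ε) / (S.kStar ^ 2 * S.lambdaMin))) =
      2 * (S.nu flbar ω x + ε) / S.kStar by field_simp]
    gcongr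
  have hnorm : ∀ ε > 0, ∀ᶠ t in atTop, ‖trackingError x xl t‖ ≤ r + ε := fun ε hε => by
    -- The slack in `hlyap` enters twice, with total coefficient `c`; the slack `ε²λ/c` therefore
    -- adds exactly `λε²`. The conclusion uses `r² + ε² ≤ (r + ε)²`.
    set c := 2 / (S.kStar ^ 2 * S.lambdaMin) + 1 with hc
    have hc0 : 0 < c := by positivity
    filter_upwards [hlyap (ε ^ 2 * S.lambdaMin / c) (by positivity)] with t ht
    have h1 : S.lambdaMin * ‖trackingError x xl t‖ ^ 2 ≤ S.lyapunov (fun i => x i t - xl t) := by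
      rw [PiLp.norm_sq_eq_of_L2]
      exact lambdaMin_mul_norm_le hnet _
    have h2 : 2 * (S.nu flbar ω x + ε ^ 2 * S.lambdaMin / c) / (S.kStar ^ 2 * S.lambdaMin) +
        ε ^ 2 * S.lambdaMin / c = S.lambdaMin * (r ^ 2 + ε ^ 2) := by
      have h3 : 2 * (S.nu flbar ω x + ε ^ 2 * S.lambdaMin / c) / (S.kStar ^ 2 * S.lambdaMin) +
        ε ^ 2 * S.lambdaMin / c = 2 * S.nu flbar ω x / (S.kStar ^ 2 * S.lambdaMin) +
          ε ^ 2 * S.lambdaMin / c * c := by rw [hc]; ring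
      rw [h3, div_mul_cancel₀ _ hc0.ne', hr2]
      field_simp
    have h4 : ‖trackingError x xl t‖ ^ 2 ≤ r ^ 2 + ε ^ 2 :=
      le_of_mul_le_mul_left (h1.trans (ht.trans_eq h2)) hlam
    refine le_of_sq_le_sq ?_ (by positivity)
    nlinarith
  refine ⟨hbdd, ⟨hr0, fun i ε hε => ?_⟩, ?_⟩
  · filter_upwards [hnorm ε hε] with t ht
    exact (PiLp.norm_apply_le (trackingError x xl t) i).trans ht
  · rw [Metric.tendsto_atTop]
    intro ε hε
    obtain ⟨T, hT⟩ := eventually_atTop.1 (hnorm (ε / 2) (by positivity))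
    refine ⟨T, fun t ht => ?_⟩
    rw [Real.dist_0_eq_abs, abs_of_nonneg Metric.infDist_nonneg]
    set e := trackingError x xl t
    have he := hT t ht
    refine lt_of_le_of_lt ?_ (half_lt_self hε)
    by_cases her : ‖e‖ ≤ r
    · rw [Metric.infDist_zero_of_mem (by simpa using her)]
      positivity
    · push Not at her
      have he0 : 0 < ‖e‖ := hr0.trans her
      -- Outside the ball, the radial projection is at distance `‖e‖ - r`.
      have hmem : (r / ‖e‖) • e ∈ Metric.closedBall (0 : PiLp 2 (fun _ : Fin n =>
          EuclideanSpace ℝ (Fin m))) r := by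
        rw [mem_closedBall_zero_iff, norm_smul, Real.norm_eq_abs, abs_of_nonneg (by positivity),
          div_mul_cancel₀ _ he0.ne']
      refine (Metric.infDist_le_dist_of_mem hmem).trans ?_
      have h5 : e - (r / ‖e‖) • e = (1 - r / ‖e‖) • e := by rw [sub_smul, one_smul]
      rw [dist_eq_norm, h5, norm_smul, Real.norm_eq_abs,
        abs_of_nonneg (sub_nonneg.2 ((div_le_one he0).2 her.le)), sub_mul, one_mul,
        div_mul_cancel₀ _ he0.ne']
      linarith

theorem ae_tracks [MeasurableSpace Ω] {P : Measure Ω} (hX : IsCompact S.X) {flbar : ℝ}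
    (hdyn : S.SmoothBoundedDynamics P) (hleader : S.BoundedLeader flbar)
    (hnet : S.ConnectedNetwork) (hker : S.RegularKernel) (hgain : ∀ i, 0 < S.gain i) :
    ∀ᵐ ω ∂P, S.Tracks flbar ω :=
  hdyn.mono fun _ h => tracks hX hleader hnet hker hgain h.1.continuousOn h.2.1.continuousOn

end LeaderFollowerMAS

namespace LeaderFollowerMAS

variable {n m : ℕ} {Ω : Type*} {S : LeaderFollowerMAS n m Ω}

/-! ### The probabilistic model error bound -/

lemma tau_sub_postMean_eq (h : S.RegularKernel) (ω : Ω) (j : Fin n) (k : Fin m) (x : S.X) :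
    S.tau ω x k - S.postMean ω j k x =
      ∑ o, S.residualCoeff j k x o * S.tau ω (S.residualPoint j x o) k
        - ∑ p, S.outputWeight j k x p * S.noise j p k ω := by
  simp only [postMean_eq h, output, Fintype.sum_option, residualCoeff, residualPoint, Option.elim,
    one_mul, neg_mul, mul_add, Finset.sum_add_distrib, Finset.sum_neg_distrib]
  ring

/-- Compactness makes the covering number finite, so `toNat` loses nothing and a minimal net with
centres in the space exists. -/
lemma exists_finset_cover (hX : IsCompact S.X) {ρ : ℝ≥0} (hρ : 0 < ρ) :
    ∃ D : Finset S.X, D.card = (Metric.coveringNumber ρ S.X).toNat ∧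
      ∀ x ∈ S.X, ∃ y ∈ D, dist x y ≤ ρ := by
  classical
  obtain ⟨N, hN, hfin, hcov⟩ := Metric.exists_finite_isCover_of_isCompact hρ.ne' hX
  have hne : Metric.coveringNumber ρ S.X ≠ ⊤ :=
    ((hcov.coveringNumber_le_encard hN).trans_lt hfin.encard_lt_top).ne
  obtain ⟨C, hC, hCfin, hCcov, hcard⟩ := Metric.exists_set_encard_eq_coveringNumber hne
  refine ⟨hCfin.toFinset.subtype (· ∈ S.X), ?_, fun x hx => ?_⟩
  · rw [Finset.card_subtype, Finset.filter_true_of_mem fun x hx => hC (hCfin.mem_toFinset.1 hx),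
      ← hcard, ← Set.ncard_eq_toFinset_card C hCfin]
    rfl
  · obtain ⟨y, hy, hxy⟩ := hCcov hx
    refine ⟨⟨y, hC hy⟩, by simpa using hy, ?_⟩
    have h1 : edist x y ≤ ρ := hxy
    exact_mod_cast edist_le_coe.1 h1


/-- The event that the posterior means for coordinate `k` are `√β σ`-accurate on `D`. -/
def accurate (S : LeaderFollowerMAS n m Ω) (D : Finset S.X) (β : ℝ) (k : Fin m) : Set Ω :=
  ⋂ j, ⋂ x ∈ D, {ω | |S.tau ω x k - S.postMean ω j k x| ≤ √β * √(S.postVar j k x)}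

/-- The σ-algebras generated by the coordinates of `τ` and by the noise variables. -/
abbrev sourceAlgebra (S : LeaderFollowerMAS n m Ω) :
    Fin m ⊕ ((Σ j, Fin (S.M j)) × Fin m) → MeasurableSpace Ω :=
  Sum.elim (fun k => MeasurableSpace.comap (fun ω (x : S.X) => S.tau ω x k) inferInstance)
    fun q => MeasurableSpace.comap (S.noise q.1.1 q.1.2 q.2) inferInstance

/-- The sources that are relevant for coordinate `k`. -/
def coordinateSources (S : LeaderFollowerMAS n m Ω) (k : Fin m) :
    Set (Fin m ⊕ ((Σ j, Fin (S.M j)) × Fin m)) :=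
  {s | s.elim id Prod.snd = k}

/-- Residuals of coordinate `k` involve only `τ_k` and the noise in that coordinate. This places the
events for different `k` in joins over disjoint index sets. -/
lemma measurableSet_accurate (h : S.RegularKernel) (D : Finset S.X) (β : ℝ) (k : Fin m) :
    MeasurableSet[⨆ s ∈ S.coordinateSources k, S.sourceAlgebra s] (S.accurate D β k) := by
  set m' := ⨆ s ∈ S.coordinateSources k, S.sourceAlgebra s
  have hτ : ∀ x : S.X, Measurable[m'] fun ω => S.tau ω x k := fun x => by
    have h1 : S.sourceAlgebra (.inl k) ≤ m' :=
      le_biSup S.sourceAlgebra (show Sum.inl k ∈ S.coordinateSources k from rfl)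
    exact ((measurable_pi_apply x).comp
      (comap_measurable fun ω (x : S.X) => S.tau ω x k)).mono h1 le_rfl
  have hε : ∀ j p, Measurable[m'] (S.noise j p k) := fun j p => by
    have h1 : S.sourceAlgebra (.inr (⟨j, p⟩, k)) ≤ m' :=
      le_biSup S.sourceAlgebra (show Sum.inr (⟨j, p⟩, k) ∈ S.coordinateSources k from rfl)
    exact (comap_measurable (S.noise j p k)).mono h1 le_rfl
  refine MeasurableSet.iInter fun j => Finset.measurableSet_biInter _ fun x _ => ?_
  simp only [tau_sub_postMean_eq h]
  refine measurableSet_le (Measurable.abs (Measurable.sub ?_ ?_)) measurable_const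
  · exact Finset.measurable_fun_sum _ fun o _ => (hτ _).const_mul _
  · exact Finset.measurable_fun_sum _ fun p _ => (hε j p).const_mul _

lemma comap_comp_le {α β : Type*} [MeasurableSpace α] [MeasurableSpace β] {φ : β → α}
    (hφ : Measurable φ) (g : Ω → β) :
    MeasurableSpace.comap (φ ∘ g) inferInstance ≤ MeasurableSpace.comap g inferInstance := by
  rw [← MeasurableSpace.comap_comp]
  exact MeasurableSpace.comap_mono hφ.comap_le

variable [MeasurableSpace Ω] {P : Measure Ω} {Lf : Ω → ℝ≥0}

/-- The prior part `U` and the noise part `V` are independent centred Gaussians. Their variances add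
up to the decomposition in `postVar_eq_residual`. -/
lemma IsGPSample.map_residual [IsProbabilityMeasure P] (hGP : S.IsGPSample P Lf)
    (h : S.RegularKernel) (j : Fin n) (k : Fin m) (x : S.X) :
    P.map (fun ω => S.tau ω x k - S.postMean ω j k x) =
      gaussianReal 0 (S.postVar j k x).toNNReal := by
  simp only [tau_sub_postMean_eq h]
  set c := S.residualCoeff j k x
  set g := S.residualPoint j x
  set α := S.outputWeight j k x
  set U : Ω → ℝ := fun ω => ∑ o, c o * S.tau ω (g o) k
  set V : Ω → ℝ := fun ω => ∑ p, α p * S.noise j p k ω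
  have hτ : ∀ o, HasGaussianLaw (fun ω => S.tau ω (g o) k) P := fun o =>
    (hGP.gaussian k).hasGaussianLaw_eval (g o)
  have hε : ∀ p, HasGaussianLaw (S.noise j p k) P := fun p => (hGP.noise_law j p k).hasGaussianLaw
  have hτ2 : ∀ o, MemLp (fun ω => c o * S.tau ω (g o) k) 2 P := fun o =>
    (hτ o).memLp_two.const_mul _
  have hε2 : ∀ p, MemLp (fun ω => α p * S.noise j p k ω) 2 P := fun p =>
    (hε p).memLp_two.const_mul _
  have hU : HasGaussianLaw U P := by
    have h1 := ((hGP.gaussian k).comp_right g).smul c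
    simpa [U] using h1.hasGaussianLaw_fun_sum (I := Finset.univ)
  have hind : iIndepFun (fun p ω => α p * S.noise j p k ω) P := by
    have h1 := hGP.noise_indep.precomp (g := fun p : Fin (S.M j) => ((⟨j, p⟩ : Σ j, Fin (S.M j)), k))
      fun p q hpq => by simpa using hpq
    exact h1.comp (fun p y => α p * y) fun p => measurable_const_mul _
  have hV : HasGaussianLaw V P :=
    iIndepFun.hasGaussianLaw_fun_sum (fun p => (hε p).fun_smul (α p)) hind
  have hUV : IndepFun U V P :=
    hGP.noise_indep_tau.comp (φ := fun F : Fin m × S.X → ℝ => ∑ o, c o * F (k, g o))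
      (ψ := fun G : (Σ j, Fin (S.M j)) × Fin m → ℝ => ∑ p, α p * G (⟨j, p⟩, k))
      (Finset.measurable_fun_sum _ fun o _ => (measurable_pi_apply _).const_mul _)
      (Finset.measurable_fun_sum _ fun p _ => (measurable_pi_apply _).const_mul _)
  have hlaw : HasGaussianLaw (fun ω => U ω - V ω) P := (hUV.hasGaussianLaw hU hV).fun_sub
  have hmean : ∫ ω, (U ω - V ω) ∂P = 0 := by
    have h1 : ∫ ω, U ω ∂P = 0 := by
      rw [integral_finsetSum _ fun o _ => (hτ o).integrable.const_mul _]
      simp [integral_const_mul, hGP.mean_zero]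
    have h2 : ∫ ω, V ω ∂P = 0 := by
      rw [integral_finsetSum _ fun p _ => (hε p).integrable.const_mul _]
      refine Finset.sum_eq_zero fun p _ => ?_
      rw [integral_const_mul, (hGP.noise_law j p k).integral_eq, integral_id_gaussianReal, mul_zero]
    rw [integral_sub hU.integrable hV.integrable, h1, h2, sub_zero]
  have hvarU : Var[U; P] = ∑ o, ∑ o', c o * c o' * S.κ k (g o) (g o') := by
    rw [← covariance_self hU.aemeasurable, covariance_fun_sum_fun_sum hτ2 hτ2]
    refine Finset.sum_congr rfl fun o _ => Finset.sum_congr rfl fun o' _ => ?_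
    rw [covariance_const_mul_left, covariance_const_mul_right, hGP.covariance_eq, mul_assoc]
  have hvarV : Var[V; P] = S.noiseVar * ∑ p, α p ^ 2 := by
    rw [show V = ∑ p, fun ω => α p * S.noise j p k ω by ext ω; simp [V],
      IndepFun.variance_sum (fun p _ => hε2 p)
      fun p _ q _ hpq => hind.indepFun hpq, Finset.mul_sum]
    refine Finset.sum_congr rfl fun p _ => ?_
    rw [variance_const_mul, (hGP.noise_law j p k).variance_eq, variance_id_gaussianReal, mul_comm]
  have hvar : Var[fun ω => U ω - V ω; P] = S.postVar j k x := by
    rw [variance_fun_sub hU.memLp_two hV.memLp_two,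
      hUV.covariance_eq_zero hU.memLp_two hV.memLp_two, hvarU, hvarV, postVar_eq_residual h]
    ring
  rw [hlaw.map_eq_gaussianReal, hmean, hvar]

lemma IsGPSample.measurable_residual (hGP : S.IsGPSample P Lf) (h : S.RegularKernel) (j : Fin n)
    (k : Fin m) (x : S.X) : Measurable fun ω => S.tau ω x k - S.postMean ω j k x := by
  simp only [tau_sub_postMean_eq h]
  exact (Finset.measurable_fun_sum _ fun o _ => (hGP.measurable_tau k _).const_mul _).sub
    (Finset.measurable_fun_sum _ fun p _ => (hGP.measurable_noise j p k).const_mul _)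

lemma IsGPSample.measure_residual_gt_le [IsProbabilityMeasure P] (hGP : S.IsGPSample P Lf)
    (h : S.RegularKernel) (j : Fin n) (k : Fin m) (x : S.X) {β : ℝ} (hβ : 0 ≤ β) :
    P {ω | √β * √(S.postVar j k x) < |S.tau ω x k - S.postMean ω j k x|} ≤
      ENNReal.ofReal (Real.exp (-β / 2)) := by
  have hv := postVar_pos h j k x
  have h1 := gaussianReal_abs_gt_le (v := (S.postVar j k x).toNNReal) (by simpa using hv)
    (r := √β * √(S.postVar j k x)) (by positivity)
  rw [← hGP.map_residual h j k x, Measure.map_apply (hGP.measurable_residual h j k x)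
    (measurableSet_lt measurable_const (by fun_prop)), mul_pow, Real.sq_sqrt hβ,
    Real.sq_sqrt hv.le, Real.coe_toNNReal _ hv.le] at h1
  convert! h1 using 3
  field_simp

lemma IsGPSample.sourceAlgebra_le (hGP : S.IsGPSample P Lf)
    (s : Fin m ⊕ ((Σ j, Fin (S.M j)) × Fin m)) : S.sourceAlgebra s ≤ ‹MeasurableSpace Ω› := by
  rcases s with k | q
  · exact (measurable_pi_lambda _ fun x => hGP.measurable_tau k x).comap_le
  · exact (hGP.measurable_noise q.1.1 q.1.2 q.2).comap_le

lemma IsGPSample.iIndep_sourceAlgebra (hGP : S.IsGPSample P Lf) : iIndep S.sourceAlgebra P := by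
  refine iIndep_sumElim ((iIndepFun_iff_iIndep ..).1 hGP.indep_coord)
    ((iIndepFun_iff_iIndep ..).1 hGP.noise_indep) ?_
  refine indep_of_indep_of_le_left (indep_of_indep_of_le_right hGP.noise_indep_tau ?_) ?_
  · exact iSup_le fun q => comap_comp_le
      (φ := fun G : (Σ j, Fin (S.M j)) × Fin m → ℝ => G q) (measurable_pi_apply q)
      fun ω q => S.noise q.1.1 q.1.2 q.2 ω
  · exact iSup_le fun k => comap_comp_le (φ := fun (F : Fin m × S.X → ℝ) (x : S.X) => F (k, x))
      (measurable_pi_lambda _ fun x => measurable_pi_apply (k, x))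
      fun ω q => S.tau ω q.2 q.1

lemma IsGPSample.measurableSet_accurate (hGP : S.IsGPSample P Lf) (h : S.RegularKernel)
    (D : Finset S.X) (β : ℝ) (k : Fin m) : MeasurableSet (S.accurate D β k) :=
  iSup₂_le (fun s _ => hGP.sourceAlgebra_le s) _ (LeaderFollowerMAS.measurableSet_accurate h D β k)

lemma IsGPSample.measure_iInter_accurate (hGP : S.IsGPSample P Lf) (h : S.RegularKernel)
    (D : Finset S.X) (β : ℝ) :
    P (⋂ k, S.accurate D β k) = ∏ k, P (S.accurate D β k) := by
  refine (iIndep_iSup_of_pairwise_disjoint hGP.sourceAlgebra_le hGP.iIndep_sourceAlgebra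
    (S := S.coordinateSources) fun k l hkl => ?_).meas_iInter
    (LeaderFollowerMAS.measurableSet_accurate h D β)
  exact Set.disjoint_left.2 fun s (hs : _ = k) (hs' : _ = l) => hkl (hs.symm.trans hs')

lemma IsGPSample.le_measure_accurate [IsProbabilityMeasure P] (hGP : S.IsGPSample P Lf)
    (h : S.RegularKernel) (D : Finset S.X) {β δ : ℝ} (hβ : 0 ≤ β)
    (hδ : D.card * n * Real.exp (-β / 2) ≤ δ) (k : Fin m) :
    ENNReal.ofReal (1 - δ) ≤ P (S.accurate D β k) := by
  have h0 : 0 ≤ δ := le_trans (by positivity) hδ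
  -- Union bound over `n` agents and the points of `D`.
  have hc : P (S.accurate D β k)ᶜ ≤ ENNReal.ofReal δ := by
    calc P (S.accurate D β k)ᶜ
        = P (⋃ j, ⋃ x ∈ D,
            {ω | √β * √(S.postVar j k x) < |S.tau ω x k - S.postMean ω j k x|}) := by
          congr 1
          ext ω
          simp [accurate]
      _ ≤ ∑ _j : Fin n, ∑ _x ∈ D, ENNReal.ofReal (Real.exp (-β / 2)) :=
          (measure_iUnion_fintype_le _ _).trans (Finset.sum_le_sum fun j _ =>
            (measure_biUnion_finset_le _ _).trans (Finset.sum_le_sum fun x _ =>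
              hGP.measure_residual_gt_le h j k x hβ))
      _ = ENNReal.ofReal (D.card * n * Real.exp (-β / 2)) := by
          rw [ENNReal.ofReal_mul (by positivity), ENNReal.ofReal_mul (by positivity)]
          simp
          ring
      _ ≤ _ := ENNReal.ofReal_le_ofReal hδ
  rw [ENNReal.ofReal_sub _ h0, ENNReal.ofReal_one, tsub_le_iff_right,
    ← prob_add_prob_compl (μ := P) (hGP.measurableSet_accurate h D β k)]
  gcongr

end LeaderFollowerMAS

/-! ### From the net to the whole space -/

namespace LeaderFollowerMAS

variable {n m : ℕ} {Ω : Type*} {S : LeaderFollowerMAS n m Ω}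

lemma beta_nonneg (hn : 0 < n) (ρ : ℝ≥0) {δ : ℝ} (hδ : 0 < δ) (hδ1 : δ < 1) :
    0 ≤ S.beta ρ δ := by
  refine mul_nonneg zero_le_two ?_
  -- In the zero case `Real.log 0 = 0` by convention; otherwise `N n ≥ 1 > δ`.
  rcases Nat.eq_zero_or_pos (Metric.coveringNumber ρ S.X).toNat with h0 | h0
  · simp [h0]
  · refine Real.log_nonneg ((one_le_div hδ).2 (hδ1.le.trans ?_))
    exact_mod_cast Nat.mul_pos h0 hn

lemma mul_exp_beta_le (ρ : ℝ≥0) {δ : ℝ} (hδ : 0 < δ) :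
    ((Metric.coveringNumber ρ S.X).toNat : ℝ) * n * Real.exp (-S.beta ρ δ / 2) ≤ δ := by
  set c : ℝ := ((Metric.coveringNumber ρ S.X).toNat : ℝ) * n with hc
  have hc0 : 0 ≤ c := by positivity
  rcases hc0.eq_or_lt with h0 | h0
  · rw [← h0, zero_mul]
    exact hδ.le
  · have h1 : -S.beta ρ δ / 2 = -Real.log (c / δ) := by
      rw [beta]
      ring
    rw [h1, Real.exp_neg, Real.exp_log (by positivity)]
    apply le_of_eq
    field_simp

/-- Compare `x` with a net point within `ρ`: `τ` and the mean each move by a Lipschitz amount, and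
`√(a + b) ≤ √a + √b` handles the standard deviation. The weights are nonnegative and sum to 1, so
the pointwise bounds average. -/
lemma errorBound_of_accurate (h : S.RegularKernel) {Lf : Ω → ℝ≥0} {D : Finset S.X} {ρ : ℝ≥0}
    {δ : ℝ} {ω : Ω} (hβ : 0 ≤ S.beta ρ δ) (hD : ∀ x ∈ S.X, ∃ y ∈ D, dist x y ≤ ρ)
    (hτ : ∀ k : Fin m, LipschitzOnWith (Lf ω) (fun x => S.tau ω x k) S.X)
    (hacc : ∀ k, ω ∈ S.accurate D (S.beta ρ δ) k) : S.ErrorBound Lf ρ δ ω := by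
  intro Lμ Lσ hμ hσ i k x hx
  obtain ⟨y, hy, hxy⟩ := hD x hx
  have hpoint : ∀ j, |S.tau ω x k - S.postMean ω j k x| ≤
      √(S.beta ρ δ) * √(S.postVar j k x)
        + ((Lf ω + Lμ j k : ℝ) * ρ + √(S.beta ρ δ * Lσ j k * ρ)) := fun j => by
    have hj : |S.tau ω y k - S.postMean ω j k y| ≤ √(S.beta ρ δ) * √(S.postVar j k y) := by
      have := hacc k
      simp only [accurate, Set.mem_iInter] at this
      exact this j y hy
    have h1 : |S.tau ω x k - S.tau ω y k| ≤ Lf ω * ρ :=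
      ((hτ k).dist_le_mul x hx y y.2).trans (by gcongr)
    have h2 : |S.postMean ω j k x - S.postMean ω j k y| ≤ Lμ j k * ρ :=
      ((hμ j k).dist_le_mul x hx y y.2).trans (by gcongr)
    have h3 : |S.postVar j k x - S.postVar j k y| ≤ Lσ j k * ρ :=
      ((hσ j k).dist_le_mul x hx y y.2).trans (by gcongr)
    have h4 : √(S.postVar j k y) ≤ √(S.postVar j k x) + √(Lσ j k * ρ) := by
      refine (Real.sqrt_le_sqrt (?_ : _ ≤ S.postVar j k x + Lσ j k * ρ)).trans
        (Real.sqrt_le_iff.2 ⟨by positivity, ?_⟩)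
      · linarith [(abs_le.1 h3).1]
      · rw [add_sq, Real.sq_sqrt (postVar_pos h j k ⟨x, hx⟩).le, Real.sq_sqrt (by positivity)]
        linarith [mul_nonneg (Real.sqrt_nonneg (S.postVar j k x))
          (Real.sqrt_nonneg (Lσ j k * ρ : ℝ))]
    have h5 := mul_le_mul_of_nonneg_left h4 (Real.sqrt_nonneg (S.beta ρ δ))
    rw [mul_add, ← Real.sqrt_mul hβ (Lσ j k * ρ), ← mul_assoc] at h5
    have h6 : |S.tau ω x k - S.postMean ω j k x| ≤ |S.tau ω x k - S.tau ω y k|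
        + |S.tau ω y k - S.postMean ω j k y| + |S.postMean ω j k x - S.postMean ω j k y| := by
      rw [abs_sub_comm (S.postMean ω j k x)]
      refine le_trans (le_of_eq ?_) (abs_add_three _ _ _)
      congr 1
      ring
    linarith
  have hw := weight_nonneg h i (k := k) (x := ⟨x, hx⟩)
  have hsum : S.tau ω x k - S.prediction ω i x k =
      ∑ j, S.weight i j k x * (S.tau ω x k - S.postMean ω j k x) := by
    simp only [mul_sub, Finset.sum_sub_distrib, ← Finset.sum_mul,
      show ∑ j, S.weight i j k x = 1 from sum_weight h i k ⟨x, hx⟩, one_mul,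
      prediction_eq_sum_weight]
  rw [hsum]
  refine (Finset.abs_sum_le_sum_abs _ _).trans (Finset.sum_le_sum fun j _ => ?_)
  rw [abs_mul, abs_of_nonneg (hw j)]
  exact mul_le_mul_of_nonneg_left (hpoint j) (hw j)

theorem IsGPSample.exists_event [MeasurableSpace Ω] {P : Measure Ω} [IsProbabilityMeasure P]
    {Lf : Ω → ℝ≥0} (hGP : S.IsGPSample P Lf) (h : S.RegularKernel) (hn : 0 < n)
    (hX : IsCompact S.X) {δ : ℝ} (hδ : 0 < δ) (hδ1 : δ < 1) {ρ : ℝ≥0} (hρ : 0 < ρ) {p : Ω → Prop}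
    (hp : ∀ᵐ ω ∂P, p ω) :
    ∃ A : Set Ω, MeasurableSet A ∧ ENNReal.ofReal ((1 - δ) ^ m) ≤ P A ∧
      ∀ ω ∈ A, S.ErrorBound Lf ρ δ ω ∧ p ω := by
  obtain ⟨D, hDcard, hD⟩ := exists_finset_cover hX hρ
  have hβ : 0 ≤ S.beta ρ δ := beta_nonneg hn ρ hδ hδ1
  -- The exceptional set need not be measurable, so a measurable null superset is removed instead.
  obtain ⟨T, hT, hTm, hT0⟩ := exists_measurable_superset_of_null
    (ae_iff.1 (hp.and hGP.lipschitz))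
  refine ⟨(⋂ k, S.accurate D (S.beta ρ δ) k) \ T,
    (MeasurableSet.iInter fun k => hGP.measurableSet_accurate h D _ k).diff hTm, ?_, ?_⟩
  · rw [measure_sdiff_null hT0, hGP.measure_iInter_accurate h,
      ENNReal.ofReal_pow (sub_nonneg.2 hδ1.le)]
    calc ENNReal.ofReal (1 - δ) ^ m = ∏ _k : Fin m, ENNReal.ofReal (1 - δ) := by simp
      _ ≤ _ := Finset.prod_le_prod' fun k _ => hGP.le_measure_accurate h D hβ
          (hDcard ▸ mul_exp_beta_le ρ hδ) k
  · rintro ω ⟨hω, hωT⟩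
    have h1 : p ω ∧ ∀ k : Fin m, LipschitzOnWith (Lf ω) (fun x => S.tau ω x k) S.X := by
      by_contra hc
      exact hωT (hT hc)
    exact ⟨errorBound_of_accurate h hβ hD h1.2 (Set.mem_iInter.1 hω), h1.1⟩

end LeaderFollowerMAS

theorem theorem1 {n m : ℕ} {Ω : Type*} [MeasurableSpace Ω] (P : Measure Ω) [IsProbabilityMeasure P]
    (S : LeaderFollowerMAS n m Ω) (flbar : ℝ)
    (hX : IsCompact S.X)
    (hdyn : S.SmoothBoundedDynamics P)
    (hleader : S.BoundedLeader flbar)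
    (hnet : S.ConnectedNetwork)
    (hker : S.RegularKernel)
    (hgain : ∀ i, 0 < S.gain i) :
    (∀ᵐ ω ∂P, S.Tracks flbar ω) ∧
    ∀ Lf : Ω → ℝ≥0, S.IsGPSample P Lf →
      ∀ δ : ℝ, 0 < δ → δ < 1 → ∀ ρ : ℝ≥0, 0 < ρ →
        ∃ A : Set Ω, MeasurableSet A ∧ ENNReal.ofReal ((1 - δ) ^ m) ≤ P A ∧
          ∀ ω ∈ A, S.ErrorBound Lf ρ δ ω ∧ S.Tracks flbar ω := by
  have htracks := LeaderFollowerMAS.ae_tracks hX hdyn hleader hnet hker hgain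
  have hn : 0 < n := Fin.pos_iff_nonempty.2 hnet.1.nonempty
  exact ⟨htracks, fun Lf hGP δ hδ hδ1 ρ hρ =>
    hGP.exists_event hker hn hX hδ hδ1 hρ htracks⟩
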